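/- Consider a system of $n$ processes, at most $t$ of which are Byzantine ($0 < t < n$), where each process is a deterministic (computable) state machine and processes communicate over authenticated reliable point-to-point links in the partially synchronous model: in every execution there is an unknown global stabilization time (GST) after which message delays are bounded by a known constant $\delta > 0$; every correct process starts by GST, and local clocks do not drift after GST. Time is discrete, and a process's local clock counts its steps. Let $\mathcal V_I \neq \emptyset$ and $\mathcal V_O$ be the (possibly infinite) sets of proposable and decidable values, whose elements are finitely encoded data. An input configuration is an assignment of proposals from $\mathcal V_I$ to a set of at least $n-t$ processes (the correct ones); $\mathcal I$ denotes the set of all input configurations. A validity property is a function $\mathit{val} : \mathcal I \to 2^{\mathcal V_O}$ with $\mathit{val}(c) \neq \emptyset$ for all $c \in \mathcal I$. An algorithm solves consensus with $\mathit{val}$ if, in every execution, every correct process decides exactly once, no two correct processes decide different values, and correct processes decide only values in $\mathit{val}(c)$, where $c$ is the input configuration of the execution. The property $\mathit{val}$ is solvable if some algorithm solves consensus with it. Theorem. Suppose $n \le 3t$. If a validity property $\mathit{val}$ is solvable, then there exists a finite procedure $\mathsf{always\_admissible}$ (a program that takes no input and halts) which returns a value $v' \in \mathcal V_O$ such that $v'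 \in \bigcap_{c \in \mathcal I} \mathit{val}(c)$. Moreover, such a procedure is obtained effectively from an algorithm: there is a computable map, depending only on $\mathcal V_I, \mathcal V_O, n, t, \delta$, which sends the program of any algorithm that solves consensus with any validity property $\mathit{val}$ to a procedure $\mathsf{always\_admissible}$ for $\mathit{val}$. Conversely, if such a procedure exists for $\mathit{val}$, then $\mathit{val}$ is solvable. Hence, for $n \le 3t$, $\mathit{val}$ is solvable if and only if a procedure $\mathsf{always\_admissible}$ for $\mathit{val}$ exists. -/

import Mathlib

open Nat.Partrec (Code)

/-! ## Input configurations and validity properties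

The system consists of the `n` processes `Fin n`, at most `t` of which are faulty. `VI` is the set of
values that can be proposed and `VO` the set of values that can be decided. -/

/-- An input configuration: an assignment of proposals to a set of at least `n - t` (and at most `n`)
processes, namely to the correct ones. `get i = none` says that process `i` is not included. -/
structure InputConfig (n t : ℕ) (VI : Type*) where
  get : Fin n → Option VI
  card_le : n - t ≤ (Finset.univ.filter fun i => (get i).isSome = true).card

/-- A validity property maps every input configuration to a non-empty set of admissible decisions. -/
structure ValidityProperty (n t : ℕ) (VI VO : Type*) where
  adm : InputConfig n t VI → Set VO
  nonempty : ∀ c, (adm c).Nonempty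

/-! ## Algorithms

Values, local states and messages are finite pieces of data. Local states and messages are represented
by natural numbers. -/

/-- The result of one computational step: the new local state, for every process the message sent to
it (if any), and the value decided in this step (if any). -/
abbrev StepResult (n : ℕ) (VO : Type*) : Type _ :=
  ℕ × List.Vector (Option ℕ) n × Option VO

/-- A message-passing algorithm with the propose/decide interface: one deterministic state machine for
every process. `init i v` is the initial local state of process `i` when it proposes `v`; in a step,
process `i` consumes its local state and the list of the (sender, message) pairs that it receives in
this step. -/
structure Algorithm (n : ℕ) (VI VO : Type*) where
  init : Fin n → VI → ℕ
  step : Fin n → ℕ → List (Fin n × ℕ) → StepResult n VO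

namespace StepResult

variable {n : ℕ} {VO : Type*}

/-- The new local state. -/
def state (r : StepResult n VO) : ℕ := r.1

/-- The message sent to process `j`, if any. -/
def msg (r : StepResult n VO) (j : Fin n) : Option ℕ := r.2.1.get j

/-- The value decided in this step, if any. -/
def decision (r : StepResult n VO) : Option VO := r.2.2

end StepResult

/-- The numerical code of a finite piece of data. -/
def codeOf {α : Type*} [Primcodable α] (a : α) : ℕ := Encodable.encode a

/-- The pair of programs `p` implements the algorithm `A`: the first program computes the initial
local states, and the second one computes the steps. -/
def Implements {n : ℕ} {VI VO : Type*} [Primcodable VI] [Primcodable VO]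
    (p : Code × Code) (A : Algorithm n VI VO) : Prop :=
  (∀ i v, p.1.eval (codeOf (i, v)) = Part.some (codeOf (A.init i v))) ∧
  ∀ i s l, p.2.eval (codeOf (i, s, l)) = Part.some (codeOf (A.step i s l))

/-! ## Executions in the partially synchronous model

Global time proceeds in ticks `0, 1, 2, …`; at every tick, every process takes at most one step. A
process has no access to global time: its local clock is the number of steps that it has taken. -/

/-- The (sender, message) pairs that arrive at `j` at time `τ`, if `sent i s j` is the message sent by
`i` to `j` at time `s` and `arrival i s j` is the time at which it arrives. -/
def arrivals {n : ℕ} (sent : Fin n → ℕ → Fin n → Option ℕ) (arrival : Fin n → ℕ → Fin n → ℕ)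
    (j : Fin n) (τ : ℕ) : List (Fin n × ℕ) :=
  (List.finRange n ×ˢ List.range τ).filterMap fun q =>
    if arrival q.1 q.2 j = τ then (sent q.1 q.2 j).map fun m => (q.1, m) else none

/-- An (infinite) execution of the algorithm `A` with at most `t` faulty processes, where `δ` is the
known bound on message delays. The components `active`, `state` and `inbox` are meaningful for correct
processes only. The messages sent by faulty processes are arbitrary. -/
structure Execution {n : ℕ} {VI VO : Type*} (t δ : ℕ) (A : Algorithm n VI VO) where
  /-- The input configuration to which the execution corresponds: the correct processes are the ones
  included in it, and their proposals are the ones specified by it. -/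
  input : InputConfig n t VI
  /-- The global stabilization time. -/
  gst : ℕ
  /-- Whether the process takes a step at the given time. -/
  active : Fin n → ℕ → Bool
  /-- The local state of the process just before the given time. -/
  state : Fin n → ℕ → ℕ
  /-- The messages, with their senders, that the process receives at the given time, in the order in
  which the network hands them over. -/
  inbox : Fin n → ℕ → List (Fin n × ℕ)
  /-- `sent i s j` is the message sent by process `i` to process `j` at time `s`, if any. -/
  sent : Fin n → ℕ → Fin n → Option ℕ
  /-- `arrival i s j` is the time at which the message sent by `i` to `j` at time `s` arrives. -/
  arrival : Fin n → ℕ → Fin n → ℕ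
  /-- A correct process starts in the initial state given by its proposal. -/
  state_zero : ∀ i v, input.get i = some v → state i 0 = A.init i v
  /-- A correct process changes its state only by taking steps of its state machine. -/
  state_succ : ∀ i, (input.get i).isSome = true → ∀ τ,
    state i (τ + 1) =
      if active i τ = true then (A.step i (state i τ) (inbox i τ)).state else state i τ
  /-- A correct process sends exactly the messages prescribed by its state machine. -/
  sent_eq : ∀ i, (input.get i).isSome = true → ∀ τ j,
    sent i τ j = if active i τ = true then (A.step i (state i τ) (inbox i τ)).msg j else none
  /-- Authenticated point-to-point links: a correct process receives, in any order, exactly the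
  messages that arrive at it, each with its true sender. -/
  inbox_perm : ∀ j, (input.get j).isSome = true → ∀ τ,
    (inbox j τ).Perm (arrivals sent arrival j τ)
  /-- Reliable links with bounded delays after GST: a message sent by a correct process to a correct
  process is received after it was sent, and at most `δ` after it was sent or after GST, whichever is
  later. -/
  arrival_le : ∀ i j, (input.get i).isSome = true → (input.get j).isSome = true → ∀ s,
    (sent i s j).isSome = true →
      s < arrival i s j ∧ arrival i s j ≤ max s gst + δ ∧ active j (arrival i s j) = true
  /-- Every correct process has started by GST, and local clocks do not drift from GST on: the process
  takes one step at every tick. (Before GST, the steps of a correct process are scheduled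
  arbitrarily.) -/
  active_of_gst_le : ∀ i, (input.get i).isSome = true → ∀ τ, gst ≤ τ → active i τ = true

namespace Execution

variable {n t δ : ℕ} {VI VO : Type*} {A : Algorithm n VI VO}

/-- Process `i` is correct in the execution. -/
def Correct (E : Execution t δ A) (i : Fin n) : Prop := (E.input.get i).isSome = true

/-- Process `i` decides `v` at time `τ`. -/
def DecidesAt (E : Execution t δ A) (i : Fin n) (τ : ℕ) (v : VO) : Prop :=
  E.active i τ = true ∧ (A.step i (E.state i τ) (E.inbox i τ)).decision = some v

end Execution

/-! ## Consensus and solvability -/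

/-- The algorithm solves consensus with the validity property `val`, in the system with at most `t`
faulty processes and message delays bounded by `δ` after GST. -/
structure SolvesConsensus {n t : ℕ} {VI VO : Type*} (δ : ℕ) (A : Algorithm n VI VO)
    (val : ValidityProperty n t VI VO) : Prop where
  /-- Every correct process decides at most once. -/
  decides_once : ∀ (E : Execution t δ A) (i : Fin n) (τ τ' : ℕ) (v v' : VO), E.Correct i →
    E.DecidesAt i τ v → E.DecidesAt i τ' v' → τ = τ'
  /-- Every correct process eventually decides. -/
  termination : ∀ (E : Execution t δ A) (i : Fin n), E.Correct i → ∃ τ v, E.DecidesAt i τ v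
  /-- No two correct processes decide different values. -/
  agreement : ∀ (E : Execution t δ A) (i j : Fin n) (τ τ' : ℕ) (v v' : VO),
    E.Correct i → E.Correct j → E.DecidesAt i τ v → E.DecidesAt j τ' v' → v = v'
  /-- Correct processes decide only admissible values. -/
  validity : ∀ (E : Execution t δ A) (i : Fin n) (τ : ℕ) (v : VO), E.Correct i →
    E.DecidesAt i τ v → v ∈ val.adm E.input

/-- A validity property is solvable if some algorithm (implemented by programs) solves consensus
with it. -/
def Solvable {n t : ℕ} {VI VO : Type*} [Primcodable VI] [Primcodable VO] (δ : ℕ)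
    (val : ValidityProperty n t VI VO) : Prop :=
  ∃ (A : Algorithm n VI VO) (p : Code × Code), Implements p A ∧ SolvesConsensus δ A val

/-- The program `q`, started without input (that is, on `0`), halts and returns a value that is
admissible for all input configurations. -/
def IsAlwaysAdmissibleProcedure {n t : ℕ} {VI VO : Type*} [Primcodable VO]
    (val : ValidityProperty n t VI VO) (q : Code) : Prop :=
  ∃ v : VO, q.eval 0 = Part.some (codeOf v) ∧ v ∈ ⋂ c : InputConfig n t VI, val.adm c

/-!
For `n ≤ 3 * t`, partitioning the network forces an algorithm that solves consensus to decide the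
same value in many unrelated executions, and that value is always admissible. Fix such an algorithm.
In the *silent run* of a set `S` of processes with given proposals, exactly the processes of `S` are
correct, the others send nothing, and everything is synchronous.

Let `S` and `S'` be such that at least `n - t` processes belong to exactly one of them. Declare
these correct, with global stabilization time `T` past the decisions of both silent runs, and delay
until `T` all messages between `S \ S'` and `S' \ S`. The other processes are faulty; until `T`,
they behave towards `S \ S'` as in the silent run of `S`, and towards `S' \ S` as in that of `S'`.
Neither side notices the difference (`runStep_split`), so by agreement the two silent runs have the
same decision (`SilentlyDecides.eq_of_symmDiff`). When `n ≤ 3 * t`, any two sets of size `n - t` are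
linked in at most two such steps, whatever the proposals: all silent runs of sets of size `n - t`
have one common decision (`SilentlyDecides.eq_of_card_eq`). That decision is admissible for every
input configuration `c`: choose `n - t` of its correct processes and let the remaining ones be slow,
so that the chosen ones decide as in their silent run (`SilentlyDecides.mem_adm`).

The procedure simulates one fixed silent run by executing the given programs, and returns the first
decision of one of its processes. The simulation is partial recursive in the programs, so the
`s-m-n` theorem turns it into a computable map from programs to procedures. Conversely, an always
admissible value is decided by the algorithm in which every process decides it in its first step.
-/

/-! ### Constructing executions -/

section Run

variable {n t : ℕ} {VI VO : Type*}

theorem arrivals_congr {sent sent' : Fin n → ℕ → Fin n → Option ℕ}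
    {arrival arrival' : Fin n → ℕ → Fin n → ℕ} {j : Fin n} {τ : ℕ}
    (h : ∀ i s, s < τ → (if arrival i s j = τ then sent i s j else none) =
      if arrival' i s j = τ then sent' i s j else none) :
    arrivals sent arrival j τ = arrivals sent' arrival' j τ := by
  unfold arrivals
  refine List.filterMap_congr fun q hq => ?_
  have hs : q.2 < τ := List.mem_range.1 (List.mem_product.1 hq).2
  have := congrArg (Option.map fun m => (q.1, m)) (h q.1 q.2 hs)
  simpa only [apply_ite (Option.map fun m => (q.1, m)), Option.map_none] using this

/-- The message sent to `j` is received one tick later. -/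
def unitDelay (_i : Fin n) (s : ℕ) (_j : Fin n) : ℕ := s + 1

theorem unitDelay_bounds {δ : ℕ} (hδ : 0 < δ) (i : Fin n) (s : ℕ) (j : Fin n) :
    s < unitDelay i s j ∧ unitDelay i s j ≤ max s 0 + δ := by
  unfold unitDelay
  omega

/-- With unit delays, the inbox at `τ + 1` holds the messages sent at `τ`, ordered by sender. -/
theorem arrivals_unitDelay_succ (sent : Fin n → ℕ → Fin n → Option ℕ) (j : Fin n) (τ : ℕ) :
    arrivals sent unitDelay j (τ + 1) =
      (List.finRange n).filterMap fun i => (sent i τ j).map fun m => (i, m) := by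
  have key : ∀ i : Fin n, ((List.range (τ + 1)).map (Prod.mk i)).filterMap (fun q =>
      if unitDelay q.1 q.2 j = τ + 1 then (sent q.1 q.2 j).map fun m => (q.1, m) else none) =
      ((sent i τ j).map fun m => (i, m)).toList := by
    intro i
    rw [List.filterMap_map, List.range_succ, List.filterMap_append,
      List.filterMap_eq_nil_iff.2 ?_]
    · cases h : sent i τ j <;> simp [unitDelay, h]
    · intro s hs
      have : s < τ := List.mem_range.1 hs
      simp [unitDelay, this.ne]
  unfold arrivals
  change List.filterMap _ (List.flatMap _ _) = _
  rw [List.filterMap_flatMap, funext key]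
  induction List.finRange n with
  | nil => rfl
  | cons a l ih =>
    rw [List.flatMap_cons, ih, List.filterMap_cons]
    cases sent a τ j <;> rfl

variable (A : Algorithm n VI VO) (c : InputConfig n t VI)
  (byz : Fin n → ℕ → Fin n → Option ℕ) (arr : Fin n → ℕ → Fin n → ℕ)

/-- The run in which the correct processes are those of `c` and take a step at every tick, the
faulty ones send the messages `byz`, and messages arrive at the times `arr`. The first component of
`history A c byz arr τ` holds the local states before `τ`; the second one holds the messages sent,
where only its values at times before `τ` are meaningful for correct processes. -/
def history : ℕ → (Fin n → ℕ) × (Fin n → ℕ → Fin n → Option ℕ)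
  | 0 => (fun i => (c.get i).elim 0 (A.init i), byz)
  | τ + 1 =>
    let h := history τ
    let r := fun i => A.step i (h.1 i) (arrivals h.2 arr i τ)
    (fun i => (r i).state,
      fun i s j => if s = τ ∧ (c.get i).isSome = true then (r i).msg j else h.2 i s j)

/-- The local state of process `i` before time `τ` in the run described at `history`. -/
def runState (i : Fin n) (τ : ℕ) : ℕ := (history A c byz arr τ).1 i

/-- The message sent by `i` to `j` at time `s` in the run described at `history`. -/
def runSent (i : Fin n) (s : ℕ) (j : Fin n) : Option ℕ := (history A c byz arr (s + 1)).2 i s j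

/-- The messages received by `j` at time `τ` in the run described at `history`. -/
def runInbox (j : Fin n) (τ : ℕ) : List (Fin n × ℕ) := arrivals (runSent A c byz arr) arr j τ

/-- The step that `i` takes at time `τ` in the run described at `history`. -/
def runStep (i : Fin n) (τ : ℕ) : StepResult n VO :=
  A.step i (runState A c byz arr i τ) (runInbox A c byz arr i τ)

variable {A c byz arr}

theorem history_sent {i j : Fin n} {s τ : ℕ} (h : s < τ) :
    (history A c byz arr τ).2 i s j = runSent A c byz arr i s j := by
  induction τ, h using Nat.le_induction with
  | base => rfl
  | succ τ h ih =>
    have hs : s ≠ τ := by omega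
    rw [← ih]
    simp [history, hs]

theorem arrivals_history (j : Fin n) (τ : ℕ) :
    arrivals (history A c byz arr τ).2 arr j τ = runInbox A c byz arr j τ :=
  arrivals_congr fun i s hs => by rw [history_sent hs]

theorem runState_zero {i : Fin n} {v : VI} (h : c.get i = some v) :
    runState A c byz arr i 0 = A.init i v := by
  simp [runState, history, h]

theorem runState_succ (i : Fin n) (τ : ℕ) :
    runState A c byz arr i (τ + 1) = (runStep A c byz arr i τ).state := by
  rw [runStep, ← arrivals_history]
  rfl

theorem runSent_correct {i : Fin n} (h : (c.get i).isSome = true) (s : ℕ) (j : Fin n) :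
    runSent A c byz arr i s j = (runStep A c byz arr i s).msg j := by
  rw [runStep, ← arrivals_history]
  simp [runSent, history, h, runState]

theorem runSent_faulty {i : Fin n} (h : ¬ (c.get i).isSome = true) (s : ℕ) (j : Fin n) :
    runSent A c byz arr i s j = byz i s j := by
  have : ∀ τ, (history A c byz arr τ).2 i s j = byz i s j := by
    intro τ
    induction τ with
    | zero => rfl
    | succ τ ih => rw [← ih]; simp [history, h]
  exact this _

variable (A c byz)

/-- The run described at `history` as an execution with global stabilization time `T`. -/
def runExecution (arr : Fin n → ℕ → Fin n → ℕ) {δ : ℕ} (T : ℕ)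
    (harr : ∀ i s j, s < arr i s j ∧ arr i s j ≤ max s T + δ) : Execution t δ A where
  input := c
  gst := T
  active _ _ := true
  state := runState A c byz arr
  inbox := runInbox A c byz arr
  sent := runSent A c byz arr
  arrival := arr
  state_zero _ _ h := runState_zero h
  state_succ i _ τ := by rw [if_pos rfl, runState_succ]; rfl
  sent_eq i h τ j := by rw [if_pos rfl, runSent_correct h]; rfl
  inbox_perm j _ τ := List.Perm.refl _
  arrival_le i j _ _ s _ := ⟨(harr i s j).1, (harr i s j).2, rfl⟩
  active_of_gst_le _ _ _ _ := rfl

variable {A c byz}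

theorem runExecution_decidesAt {δ T : ℕ}
    {harr : ∀ i s j, s < arr i s j ∧ arr i s j ≤ max s T + δ} {i : Fin n} {τ : ℕ} {v : VO} :
    (runExecution A c byz arr T harr).DecidesAt i τ v ↔
      (runStep A c byz arr i τ).decision = some v :=
  and_iff_right rfl

variable (A c)

/-! ### Silent runs and split runs -/

/-- The messages of the faulty processes that never send any. -/
def silent : Fin n → ℕ → Fin n → Option ℕ := fun _ _ _ => none

/-- In the silent run with input `c`, the faulty processes are silent and all delays are one tick.
This is the step that `i` takes at time `τ` in it. -/
abbrev silentStep (i : Fin n) (τ : ℕ) : StepResult n VO := runStep A c silent unitDelay i τ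

/-- The delays of a split run: until time `T`, the processes of the two sides of `g` do not hear
from the correct processes of the other side; all other messages take one tick. -/
def splitDelay (T : ℕ) (g : Fin n → Bool) (i : Fin n) (s : ℕ) (j : Fin n) : ℕ :=
  if s < T ∧ (c.get i).isSome = true ∧ g i ≠ g j then T else s + 1

/-- The messages of the faulty processes of a split run: until time `T`, each of them sends to the
processes of side `k` what `ref k` prescribes. -/
def splitByz (T : ℕ) (g : Fin n → Bool) (ref : Bool → Fin n → ℕ → Fin n → Option ℕ) :
    Fin n → ℕ → Fin n → Option ℕ :=
  fun i s j => if s < T then ref (g j) i s j else none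

variable {A c}

/-- Until time `T`, the correct processes of side `k` cannot distinguish the split run from a silent
run with input `c'`, provided that the faulty processes play their part in the silent run towards
side `k`, and that the correct processes of the other side are silent in it. -/
theorem runStep_split {c' : InputConfig n t VI} {T : ℕ} {g : Fin n → Bool}
    {ref : Bool → Fin n → ℕ → Fin n → Option ℕ} {k : Bool}
    (href : ref k = runSent A c' silent unitDelay)
    (hin : ∀ i, (c.get i).isSome = true → g i = k → c'.get i = c.get i)
    (hout : ∀ i, (c.get i).isSome = true → g i ≠ k → c'.get i = none)
    {j : Fin n} (hj : (c.get j).isSome = true) (hgj : g j = k) {τ : ℕ} (hτ : τ < T) :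
    runStep A c (splitByz T g ref) (splitDelay c T g) j τ = silentStep A c' j τ := by
  induction τ using Nat.strong_induction_on generalizing j with
  | _ τ ih =>
  have hstate : runState A c (splitByz T g ref) (splitDelay c T g) j τ =
      runState A c' silent unitDelay j τ := by
    cases τ with
    | zero =>
      obtain ⟨v, hv⟩ := Option.isSome_iff_exists.1 hj
      rw [runState_zero hv, runState_zero ((hin j hj hgj).trans hv)]
    | succ τ =>
      rw [runState_succ, runState_succ, ih τ τ.lt_succ_self hj hgj (by omega)]
  have hinbox : runInbox A c (splitByz T g ref) (splitDelay c T g) j τ =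
      runInbox A c' silent unitDelay j τ := by
    refine arrivals_congr fun i s hs => ?_
    have hsT : s < T := hs.trans hτ
    by_cases hi : (c.get i).isSome = true
    · by_cases hgi : g i = k
      · have hi' : (c'.get i).isSome = true := by rwa [hin i hi hgi]
        rw [runSent_correct hi, runSent_correct hi', ih s hs hi hgi hsT]
        simp only [splitDelay, hgi, hgj, ne_eq, not_true_eq_false, and_false, if_false]
        rfl
      · have hi' : ¬ (c'.get i).isSome = true := by simp [hout i hi hgi]
        rw [runSent_faulty hi']
        have : splitDelay c T g i s j = T := by simp [splitDelay, hsT, hi, hgi, hgj]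
        rw [this, if_neg hτ.ne']
        simp [silent]
    · rw [runSent_faulty hi]
      simp only [splitDelay, splitByz, hi, hsT, hgj, href, if_true]
      rfl
  rw [silentStep, runStep, runStep, hstate, hinbox]

theorem splitDelay_bounds {δ : ℕ} (hδ : 0 < δ) (T : ℕ) (g : Fin n → Bool) (i : Fin n) (s : ℕ)
    (j : Fin n) :
    s < splitDelay c T g i s j ∧ splitDelay c T g i s j ≤ max s T + δ := by
  unfold splitDelay
  split_ifs with h <;> omega

end Run

/-! ### Decisions in silent runs -/

section Decisions

variable {n t δ : ℕ} {VI VO : Type*}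

/-- The input configuration in which the correct processes are those in `S`, with proposals `f`. -/
def InputConfig.ofFinset (S : Finset (Fin n)) (hS : n - t ≤ S.card) (f : Fin n → VI) :
    InputConfig n t VI where
  get i := if i ∈ S then some (f i) else none
  card_le := by simpa using hS

theorem InputConfig.ofFinset_isSome {S : Finset (Fin n)} {hS : n - t ≤ S.card} {f : Fin n → VI}
    {i : Fin n} : ((InputConfig.ofFinset S hS f).get i).isSome = true ↔ i ∈ S := by
  by_cases h : i ∈ S <;> simp [InputConfig.ofFinset, h]

/-- Some correct process decides `v` in the silent run with input `c`. -/
def SilentlyDecides (A : Algorithm n VI VO) (c : InputConfig n t VI) (v : VO) : Prop :=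
  ∃ i τ, (c.get i).isSome = true ∧ (silentStep A c i τ).decision = some v

variable {A : Algorithm n VI VO} {val : ValidityProperty n t VI VO}

theorem SolvesConsensus.exists_silent_decision (hA : SolvesConsensus δ A val) (hδ : 0 < δ)
    (c : InputConfig n t VI) {i : Fin n} (hi : (c.get i).isSome = true) :
    ∃ τ v, (silentStep A c i τ).decision = some v := by
  obtain ⟨τ, v, h⟩ :=
    hA.termination (runExecution A c silent unitDelay 0 (unitDelay_bounds hδ)) i hi
  exact ⟨τ, v, runExecution_decidesAt.1 h⟩

theorem SilentlyDecides.decision (hA : SolvesConsensus δ A val) (hδ : 0 < δ)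
    {c : InputConfig n t VI} {v : VO} (h : SilentlyDecides A c v) {i : Fin n}
    (hi : (c.get i).isSome = true) : ∃ τ, (silentStep A c i τ).decision = some v := by
  obtain ⟨j, σ, hj, hσ⟩ := h
  obtain ⟨τ, w, hτ⟩ := hA.exists_silent_decision hδ c hi
  have : w = v := hA.agreement (runExecution A c silent unitDelay 0 (unitDelay_bounds hδ))
    i j τ σ w v hi hj (runExecution_decidesAt.2 hτ) (runExecution_decidesAt.2 hσ)
  exact ⟨τ, this ▸ hτ⟩

/-- A decision of the silent run of a subset of the correct processes is admissible: the other
correct processes may be so slow that they look silent until the decision is made. -/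
theorem SilentlyDecides.mem_adm (hA : SolvesConsensus δ A val) (hδ : 0 < δ)
    {c c' : InputConfig n t VI} (hle : ∀ i, (c'.get i).isSome = true → c.get i = c'.get i) {v : VO}
    (h : SilentlyDecides A c' v) : v ∈ val.adm c := by
  obtain ⟨i, τ, hi, hτ⟩ := h
  have hi' : (c.get i).isSome = true := by rwa [hle i hi]
  let g : Fin n → Bool := fun i => (c'.get i).isSome
  let ref : Bool → Fin n → ℕ → Fin n → Option ℕ := fun _ => runSent A c' silent unitDelay
  have hstep := runStep_split (A := A) (c := c) (c' := c') (T := τ + 1) (g := g) (ref := ref)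
    (k := true) rfl (fun j _ hj => (hle j hj).symm) (fun j _ hj => by simpa [g] using hj)
    hi' hi τ.lt_succ_self
  refine hA.validity (runExecution A c (splitByz (τ + 1) g ref) (splitDelay c (τ + 1) g) (τ + 1)
    (splitDelay_bounds hδ _ g)) i τ v hi' (runExecution_decidesAt.2 ?_)
  rw [hstep, hτ]

/-- Partitioning argument: if the processes in exactly one of `S` and `S'` are numerous enough to be
the correct ones, then the faulty processes can make `S \ S'` believe in a silent run of `S` and `S'
\ S` in a silent run of `S'`, whence the two silent runs have the same decision. -/
theorem SilentlyDecides.eq_of_symmDiff (hA : SolvesConsensus δ A val) (hδ : 0 < δ)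
    {S S' : Finset (Fin n)} {hS : n - t ≤ S.card} {hS' : n - t ≤ S'.card} {f f' : Fin n → VI}
    (hcard : n - t ≤ (symmDiff S S').card) (hne : (S \ S').Nonempty) (hne' : (S' \ S).Nonempty)
    {v v' : VO} (h : SilentlyDecides A (.ofFinset S hS f) v)
    (h' : SilentlyDecides A (.ofFinset S' hS' f') v') : v = v' := by
  obtain ⟨i, hi⟩ := hne
  obtain ⟨i', hi'⟩ := hne'
  rw [Finset.mem_sdiff] at hi hi'
  obtain ⟨τ, hτ⟩ := h.decision hA hδ (InputConfig.ofFinset_isSome.2 hi.1)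
  obtain ⟨τ', hτ'⟩ := h'.decision hA hδ (InputConfig.ofFinset_isSome.2 hi'.1)
  let T := max τ τ' + 1
  let c : InputConfig n t VI := .ofFinset (symmDiff S S') hcard fun j => if j ∈ S then f j else f' j
  let g : Fin n → Bool := fun j => decide (j ∈ S)
  let ref : Bool → Fin n → ℕ → Fin n → Option ℕ := fun b =>
    bif b then runSent A (.ofFinset S hS f) silent unitDelay
    else runSent A (.ofFinset S' hS' f') silent unitDelay
  have hc : ∀ j, (c.get j).isSome = true ↔ (j ∈ S ∧ j ∉ S') ∨ (j ∈ S' ∧ j ∉ S) := fun j => by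
    rw [InputConfig.ofFinset_isSome, Finset.mem_symmDiff]
  have hstep := runStep_split (A := A) (c := c) (c' := .ofFinset S hS f) (T := T) (g := g)
    (ref := ref) (k := true) rfl
    (fun j hj hg => by
      have := (hc j).1 hj
      have hjS : j ∈ S := by simpa [g] using hg
      simp [c, InputConfig.ofFinset, Finset.mem_symmDiff, hjS]
      tauto)
    (fun j _ hg => by
      have hjS : j ∉ S := by simpa [g] using hg
      simp [InputConfig.ofFinset, hjS])
    ((hc i).2 (Or.inl hi)) (by simp [g, hi.1]) (show τ < T by omega)
  have hstep' := runStep_split (A := A) (c := c) (c' := .ofFinset S' hS' f') (T := T) (g := g)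
    (ref := ref) (k := false) rfl
    (fun j hj hg => by
      have := (hc j).1 hj
      have hjS : j ∉ S := by simpa [g] using hg
      simp [c, InputConfig.ofFinset, Finset.mem_symmDiff, hjS])
    (fun j hj hg => by
      have := (hc j).1 hj
      have hjS : j ∈ S := by simpa [g] using hg
      have hjS' : j ∉ S' := by tauto
      simp [InputConfig.ofFinset, hjS'])
    ((hc i').2 (Or.inr hi')) (by simp [g, hi'.2]) (show τ' < T by omega)
  refine hA.agreement (runExecution A c (splitByz T g ref) (splitDelay c T g) T
    (splitDelay_bounds hδ T g)) i i' τ τ' v v' ((hc i).2 (Or.inl hi)) ((hc i').2 (Or.inr hi'))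
    (runExecution_decidesAt.2 ?_) (runExecution_decidesAt.2 ?_)
  · rw [hstep, hτ]
  · rw [hstep', hτ']

/-- If `n ≤ 3 * t`, all silent runs with `n - t` correct processes have the same decision: unless
the two sets of correct processes are disjoint, both are linked by the partitioning argument to the
complement of a part of their intersection. -/
theorem SilentlyDecides.eq_of_card_eq (hA : SolvesConsensus δ A val) (ht : 0 < t) (htn : t < n)
    (hδ : 0 < δ) (hn : n ≤ 3 * t) {S S' : Finset (Fin n)} (hS : S.card = n - t)
    (hS' : S'.card = n - t) {f f' : Fin n → VI} {v v' : VO}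
    (h : SilentlyDecides A (.ofFinset S hS.ge f) v)
    (h' : SilentlyDecides A (.ofFinset S' hS'.ge f') v') : v = v' := by
  by_cases hdisj : Disjoint S S'
  · refine SilentlyDecides.eq_of_symmDiff hA hδ ?_ ?_ ?_ h h'
    · rw [hdisj.symmDiff_eq_sup, Finset.sup_eq_union, Finset.card_union_of_disjoint hdisj]
      omega
    · rw [Finset.sdiff_eq_self_of_disjoint hdisj, ← Finset.card_pos]; omega
    · rw [Finset.sdiff_eq_self_of_disjoint hdisj.symm, ← Finset.card_pos]; omega
  · have hpos : 0 < (S ∩ S').card :=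
      Finset.card_pos.2 (Finset.not_disjoint_iff_nonempty_inter.1 hdisj)
    have hunion : (S ∪ S').card ≤ n := by simpa using Finset.card_le_univ (S ∪ S')
    have hinter := Finset.card_union_add_card_inter S S'
    -- The partitioning argument leaves `S \ F` and `S' \ F` faulty, so `F` needs `n - 2 * t`
    -- elements; it must also be non-empty and, to be absent in a silent run, of size at most `t`.
    obtain ⟨F, hF, hFcard⟩ := Finset.exists_subset_card_eq
      (show max 1 (n - 2 * t) ≤ (S ∩ S').card by omega)
    have hFc : n - t ≤ Fᶜ.card := by
      rw [Finset.card_compl, Fintype.card_fin]; omega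
    have hlink : ∀ {R : Finset (Fin n)}, R.card = n - t → F ⊆ R →
        n - t ≤ (symmDiff R Fᶜ).card ∧ (R \ Fᶜ).Nonempty ∧ (Fᶜ \ R).Nonempty := by
      intro R hR hFR
      have h₁ : R \ Fᶜ = F := by rw [sdiff_compl]; exact Finset.inter_eq_right.2 hFR
      have h₂ : Fᶜ \ R = Rᶜ := by
        ext x; simp only [Finset.mem_sdiff, Finset.mem_compl]
        exact ⟨fun hx => hx.2, fun hx => ⟨fun hxF => hx (hFR hxF), hx⟩⟩
      have hRc : Rᶜ.card = t := by
        rw [Finset.card_compl, Fintype.card_fin]; omega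
      refine ⟨?_, ?_, ?_⟩
      · rw [symmDiff_def, h₁, h₂, Finset.sup_eq_union, Finset.card_union_of_disjoint
          (disjoint_compl_right.mono_left hFR)]
        omega
      · rw [h₁, ← Finset.card_pos]; omega
      · rw [h₂, ← Finset.card_pos]; omega
    obtain ⟨l₁, l₂, l₃⟩ := hlink hS (hF.trans Finset.inter_subset_left)
    obtain ⟨l₁', l₂', l₃'⟩ := hlink hS' (hF.trans Finset.inter_subset_right)
    obtain ⟨j, hj⟩ : (Fᶜ).Nonempty := by rw [← Finset.card_pos]; omega
    obtain ⟨τ, w, hw⟩ := hA.exists_silent_decision hδ (.ofFinset Fᶜ hFc f)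
      (InputConfig.ofFinset_isSome.2 hj)
    have hw : SilentlyDecides A (.ofFinset Fᶜ hFc f) w :=
      ⟨j, τ, InputConfig.ofFinset_isSome.2 hj, hw⟩
    exact (h.eq_of_symmDiff hA hδ l₁ l₂ l₃ hw).trans (h'.eq_of_symmDiff hA hδ l₁' l₂' l₃' hw).symm

/-- If `n ≤ 3 * t`, a decision of any silent run with `n - t` correct processes is admissible for
all input configurations. -/
theorem SilentlyDecides.mem_iInter_adm [Nonempty VI] (hA : SolvesConsensus δ A val) (ht : 0 < t)
    (htn : t < n) (hδ : 0 < δ) (hn : n ≤ 3 * t) {S : Finset (Fin n)} (hS : S.card = n - t)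
    {f : Fin n → VI} {v : VO} (h : SilentlyDecides A (.ofFinset S hS.ge f) v) :
    v ∈ ⋂ c : InputConfig n t VI, val.adm c := by
  refine Set.mem_iInter.2 fun c => ?_
  obtain ⟨R, hR, hRcard⟩ := Finset.exists_subset_card_eq c.card_le
  let f' : Fin n → VI := fun i => (c.get i).getD (Classical.arbitrary VI)
  obtain ⟨j, hj⟩ : R.Nonempty := by rw [← Finset.card_pos]; omega
  have hj' := (InputConfig.ofFinset_isSome (hS := hRcard.ge) (f := f')).2 hj
  obtain ⟨τ, w, hw⟩ := hA.exists_silent_decision hδ (.ofFinset R hRcard.ge f') hj'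
  have hw : SilentlyDecides A (.ofFinset R hRcard.ge f') w := ⟨j, τ, hj', hw⟩
  rw [h.eq_of_card_eq hA ht htn hδ hn hS hRcard hw]
  refine hw.mem_adm hA hδ fun i hi => ?_
  have hiR := InputConfig.ofFinset_isSome.1 hi
  obtain ⟨u, hu⟩ := Option.isSome_iff_exists.1 (Finset.mem_filter.1 (hR hiR)).2
  simp [InputConfig.ofFinset, hiR, f', hu]

end Decisions

/-! ### Simulating a silent run -/

section Programs

variable {α β γ : Type*} [Primcodable α] [Primcodable β] [Primcodable γ]

theorem Partrec.exists_code {f : α →. β} (hf : Partrec f) :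
    ∃ q : Code, ∀ a, q.eval (codeOf a) = (f a).map codeOf := by
  obtain ⟨q, hq⟩ := Nat.Partrec.Code.exists_code.1 hf
  refine ⟨q, fun a => ?_⟩
  rw [hq]
  simp [codeOf]
  rfl

theorem Computable.exists_code {f : α → β} (hf : Computable f) :
    ∃ q : Code, ∀ a, q.eval (codeOf a) = Part.some (codeOf (f a)) := by
  obtain ⟨q, hq⟩ := Partrec.exists_code hf
  exact ⟨q, fun a => by rw [hq]; simp⟩

/-- The `s-m-n` theorem for partial functions between encodable types. -/
theorem Partrec.exists_computable_code {f : α →. β} (hf : Partrec f) :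
    ∃ q : α → Code, Computable q ∧ ∀ a, (q a).eval 0 = (f a).map codeOf := by
  obtain ⟨q, hq⟩ := Partrec.exists_code (hf.comp (Computable.fst (α := α) (β := ℕ)))
  refine ⟨fun a => q.curry (codeOf a), ?_, fun a => ?_⟩
  · exact (Nat.Partrec.Code.primrec₂_curry.comp (Primrec.const q) Primrec.encode).to_comp
  · rw [Nat.Partrec.Code.eval_curry]
    exact hq (a, 0)

end Programs

section Simulation

variable {n t : ℕ} {VI VO : Type*}

/-- The result of a step that leads to state `s`, with no message sent and no decision made. It also
serves as the entry of the processes outside `S` in a `snapshot`. -/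
def idle (n : ℕ) (VO : Type*) (s : ℕ) : StepResult n VO := (s, List.Vector.ofFn fun _ => none, none)

/-- The inbox of `j`, ordered by sender, if `σ` holds the results of the last steps. -/
def inboxOf (σ : List.Vector (StepResult n VO) n) (j : Fin n) : List (Fin n × ℕ) :=
  (List.finRange n).filterMap fun i => ((σ.get i).msg j).map fun m => (i, m)

/-- The results of the steps at time `τ - 1` in the silent run of `S` with proposals `f`. At time
`0`, they consist of the initial states only. -/
def snapshot (A : Algorithm n VI VO) (S : Finset (Fin n)) (hS : n - t ≤ S.card) (f : Fin n → VI) :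
    ℕ → List.Vector (StepResult n VO) n
  | 0 => List.Vector.ofFn fun i => idle n VO (if i ∈ S then A.init i (f i) else 0)
  | τ + 1 => List.Vector.ofFn fun i =>
      if i ∈ S then silentStep A (InputConfig.ofFinset (t := t) S hS f) i τ else idle n VO 0

theorem idle_msg (s : ℕ) (j : Fin n) : (idle n VO s).msg j = none := by
  simp [idle, StepResult.msg]

variable {A : Algorithm n VI VO} {S : Finset (Fin n)} {hS : n - t ≤ S.card} {f : Fin n → VI}

theorem step_snapshot {i : Fin n} (hi : i ∈ S) (τ : ℕ) :
    A.step i ((snapshot A S hS f τ).get i).state (inboxOf (snapshot A S hS f τ) i) =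
      silentStep A (InputConfig.ofFinset S hS f) i τ := by
  have hstate : ((snapshot A S hS f τ).get i).state =
      runState A (InputConfig.ofFinset S hS f) silent unitDelay i τ := by
    cases τ with
    | zero =>
      rw [runState_zero (v := f i) (by simp [InputConfig.ofFinset, hi])]
      simp [snapshot, hi, idle, StepResult.state]
    | succ τ => simp [snapshot, hi, runState_succ]
  have hinbox : inboxOf (snapshot A S hS f τ) i =
      runInbox A (InputConfig.ofFinset S hS f) silent unitDelay i τ := by
    cases τ with
    | zero => simp [inboxOf, snapshot, idle_msg, runInbox, arrivals]
    | succ τ =>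
      rw [runInbox, arrivals_unitDelay_succ, inboxOf]
      refine List.filterMap_congr fun j _ => ?_
      by_cases hj : j ∈ S
      · rw [runSent_correct (InputConfig.ofFinset_isSome.2 hj)]
        simp [snapshot, hj]
      · rw [runSent_faulty (mt InputConfig.ofFinset_isSome.1 hj)]
        simp [snapshot, hj, idle_msg, silent]
  rw [hstate, hinbox]
  rfl

variable [Primcodable VI] [Primcodable VO] (S f)

/-- The snapshot at time `0`, computed by running the programs `p`. -/
def simulateInit (VO : Type*) (p : Code × Code) : Part (List.Vector (StepResult n VO) n) :=
  List.Vector.mOfFn fun i =>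
    if i ∈ S then (p.1.eval (codeOf (i, f i))).map (idle n VO) else Part.some (idle n VO 0)

/-- The next snapshot, computed from the snapshot `σ` by running the programs `p`. -/
def simulateStep (p : Code × Code) (σ : List.Vector (StepResult n VO) n) :
    Part (List.Vector (StepResult n VO) n) :=
  List.Vector.mOfFn fun i =>
    if i ∈ S then (p.2.eval (codeOf (i, (σ.get i).state, inboxOf σ i))).bind fun m =>
      (Encodable.decode (α := StepResult n VO) m : Part (StepResult n VO))
    else Part.some (idle n VO 0)

/-- The snapshot at time `τ`, computed by running the programs `p`. -/
def simulate (VO : Type*) [Primcodable VO] (p : Code × Code) (τ : ℕ) :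
    Part (List.Vector (StepResult n VO) n) :=
  Nat.rec (simulateInit S f VO p) (fun _ σ => σ.bind (simulateStep S p)) τ

/-- The decision of process `i` in the silent run of `S` with proposals `f`, computed by running the
programs `p`. It is undefined if there is none. -/
def simulatedDecision (VO : Type*) [Primcodable VO] (i : Fin n) (p : Code × Code) : Part VO :=
  (Nat.rfind fun τ => (simulate S f VO p τ).map fun σ => (σ.get i).decision.isSome).bind fun τ =>
    (simulate S f VO p τ).bind fun σ => ((σ.get i).decision : Part VO)

variable {S f}

theorem mOfFn_eq_some {α : Type*} {F : Fin n → Part α} {g : Fin n → α}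
    (h : ∀ i, F i = Part.some (g i)) :
    List.Vector.mOfFn F = Part.some (List.Vector.ofFn g) := by
  rw [show F = fun i => pure (g i) from funext h, List.Vector.mOfFn_pure]
  rfl

theorem simulate_eq (hS : n - t ≤ S.card) {p : Code × Code} (hp : Implements p A) (τ : ℕ) :
    simulate S f VO p τ = Part.some (snapshot A S hS f τ) := by
  induction τ with
  | zero =>
    refine mOfFn_eq_some fun i => ?_
    by_cases hi : i ∈ S
    · simp only [hi, if_true]
      rw [hp.1, Part.map_some]
      rfl
    · simp only [hi, if_false]
  | succ τ ih =>
    change (simulate S f VO p τ).bind (simulateStep S p) = _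
    rw [ih, Part.bind_some]
    refine mOfFn_eq_some fun i => ?_
    by_cases hi : i ∈ S
    · simp only [hi, if_true]
      rw [hp.2, Part.bind_some, codeOf, Encodable.encodek, step_snapshot hi]
      rfl
    · simp only [hi, if_false]

theorem simulatedDecision_eq (hS : n - t ≤ S.card) {p : Code × Code} (hp : Implements p A)
    {i : Fin n} (hi : i ∈ S)
    (h : ∃ τ v, (silentStep A (InputConfig.ofFinset S hS f) i τ).decision = some v) :
    ∃ v, simulatedDecision S f VO i p = Part.some v ∧
      SilentlyDecides A (InputConfig.ofFinset S hS f) v := by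
  have hfind : ∀ τ, (simulate S f VO p τ).map (fun σ => (σ.get i).decision.isSome) =
      Part.some ((snapshot A S hS f τ).get i).decision.isSome := fun τ => by
    rw [simulate_eq hS hp, Part.map_some]
  obtain ⟨τ, v, hτ⟩ := h
  have hex : ((snapshot A S hS f (τ + 1)).get i).decision.isSome = true := by
    simp [snapshot, hi, hτ]
  obtain ⟨σ, hσ, -⟩ := Nat.rfind_min'
    (p := fun τ => ((snapshot A S hS f τ).get i).decision.isSome) hex
  obtain ⟨w, hw⟩ := Option.isSome_iff_exists.1
    (show ((snapshot A S hS f σ).get i).decision.isSome = true by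
      exact (Part.mem_some_iff.1 (Nat.rfind_spec hσ)).symm)
  refine ⟨w, ?_, i, ?_⟩
  · have hrfind : (Nat.rfind fun τ =>
        (simulate S f VO p τ).map fun σ => (σ.get i).decision.isSome) = Part.some σ :=
      (congrArg Nat.rfind (funext hfind)).trans (Part.eq_some_iff.2 hσ)
    rw [simulatedDecision, hrfind, Part.bind_some, simulate_eq hS hp, Part.bind_some, hw]
    rfl
  · cases σ with
    | zero => simp [snapshot, idle, StepResult.decision] at hw
    | succ σ => exact ⟨σ, InputConfig.ofFinset_isSome.2 hi, by simpa [snapshot, hi] using hw⟩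

theorem computable_idle : Computable (idle n VO) :=
  Computable.id.pair (Computable.const _)

theorem primrec_inboxOf (j : Fin n) :
    Primrec fun σ : List.Vector (StepResult n VO) n => inboxOf σ j := by
  refine Primrec.listFilterMap (Primrec.const _) ?_
  refine Primrec.option_map ?_ ?_
  · exact Primrec.vector_get.comp
      (Primrec.fst.comp (Primrec.snd.comp (Primrec.vector_get.comp Primrec.fst Primrec.snd)))
      (Primrec.const j)
  · exact Primrec.pair (Primrec.snd.comp Primrec.fst) Primrec.snd

theorem partrec_simulateInit : Partrec (simulateInit (n := n) S f VO) := by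
  refine Partrec.vector_mOfFn fun i => ?_
  by_cases hi : i ∈ S
  · simp only [hi, if_true]
    exact (Nat.Partrec.Code.eval_part.comp Computable.fst (Computable.const _)).map
      (computable_idle.comp Computable.snd).to₂
  · simp only [hi, if_false]
    exact Computable.const (idle n VO 0)

theorem partrec_simulateStep : Partrec₂ (simulateStep (n := n) (VO := VO) S) := by
  refine Partrec.vector_mOfFn fun i => ?_
  by_cases hi : i ∈ S
  · simp only [hi, if_true]
    refine Partrec.bind (Nat.Partrec.Code.eval_part.comp (Computable.snd.comp Computable.fst) ?_)
      (Computable.ofOption (Computable.decode.comp Computable.snd))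
    refine Computable.encode.comp (Computable.pair (Computable.const i) (Computable.pair ?_ ?_))
    · exact Computable.fst.comp (Computable.vector_get.comp Computable.snd (Computable.const i))
    · exact (primrec_inboxOf i).to_comp.comp Computable.snd
  · simp only [hi, if_false]
    exact Computable.const (idle n VO 0)

theorem partrec_simulate : Partrec₂ (simulate (n := n) S f VO) := by
  exact Partrec.nat_rec (α := (Code × Code) × ℕ) (h := fun a x => simulateStep S a.1 x.2)
    Computable.snd (partrec_simulateInit.comp Computable.fst)
    (partrec_simulateStep.comp (Computable.fst.comp Computable.fst)
      (Computable.snd.comp Computable.snd))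

theorem partrec_simulatedDecision (i : Fin n) : Partrec (simulatedDecision S f VO i) := by
  have hdec : Computable fun σ : List.Vector (StepResult n VO) n => (σ.get i).decision :=
    Computable.snd.comp (Computable.snd.comp
      (Computable.vector_get.comp Computable.id (Computable.const i)))
  refine Partrec.bind (Partrec.rfind ?_) ?_
  · exact partrec_simulate.map
      (Primrec.option_isSome.to_comp.comp (hdec.comp Computable.snd))
  · exact Partrec.bind partrec_simulate (Computable.ofOption (hdec.comp Computable.snd))

end Simulation

/-! ### Deciding a constant -/

section Constant

variable {n t δ : ℕ} {VI VO : Type*}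

/-- Every process decides `v` in its first step, and never sends a message. The local state tells
whether a step has been taken. -/
def constantAlgorithm (n : ℕ) (VI : Type*) {VO : Type*} (v : VO) : Algorithm n VI VO where
  init _ _ := 0
  step _ s _ := (1, List.Vector.ofFn fun _ => none, if s = 0 then some v else none)

theorem constantAlgorithm_implements [Primcodable VI] [Primcodable VO] (v : VO) :
    ∃ p : Code × Code, Implements p (constantAlgorithm n VI v) := by
  obtain ⟨q₁, h₁⟩ := Computable.exists_code
    (Computable.const 0 : Computable fun _ : Fin n × VI => 0)
  have hstep : Primrec fun x : Fin n × ℕ × List (Fin n × ℕ) =>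
      (constantAlgorithm n VI v).step x.1 x.2.1 x.2.2 := by
    refine (Primrec.const 1).pair ((Primrec.const _).pair ?_)
    exact Primrec.ite (Primrec.eq.comp (Primrec.fst.comp Primrec.snd) (Primrec.const 0))
      (Primrec.const _) (Primrec.const _)
  obtain ⟨q₂, h₂⟩ := Computable.exists_code hstep.to_comp
  exact ⟨(q₁, q₂), fun i v => h₁ (i, v), fun i s l => h₂ (i, s, l)⟩

theorem constantAlgorithm_decidesAt {v w : VO} {E : Execution t δ (constantAlgorithm n VI v)}
    {i : Fin n} {τ : ℕ} :
    E.DecidesAt i τ w ↔ E.active i τ = true ∧ E.state i τ = 0 ∧ v = w := by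
  simp [Execution.DecidesAt, constantAlgorithm, StepResult.decision]

theorem constantAlgorithm_solves {v : VO} {val : ValidityProperty n t VI VO}
    (hv : v ∈ ⋂ c : InputConfig n t VI, val.adm c) :
    SolvesConsensus δ (constantAlgorithm n VI v) val := by
  have hsucc : ∀ (E : Execution t δ (constantAlgorithm n VI v)) i, E.Correct i → ∀ τ,
      E.state i (τ + 1) = if E.active i τ = true then 1 else E.state i τ :=
    fun E i hi τ => E.state_succ i hi τ
  -- A process that has taken a step remains in state `1`, and does not decide again.
  have hlt : ∀ (E : Execution t δ (constantAlgorithm n VI v)) i, E.Correct i → ∀ τ τ',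
      τ < τ' → E.active i τ = true → E.state i τ' = 1 := by
    intro E i hi τ τ' h hact
    induction τ', h using Nat.le_induction with
    | base => rw [hsucc E i hi, if_pos hact]
    | succ τ' _ ih => rw [hsucc E i hi, ih, ite_self]
  refine ⟨?_, ?_, ?_, ?_⟩
  · intro E i τ τ' w w' hi h h'
    rw [constantAlgorithm_decidesAt] at h h'
    rcases lt_trichotomy τ τ' with hl | hl | hl
    · have := hlt E i hi _ _ hl h.1; omega
    · exact hl
    · have := hlt E i hi _ _ hl h'.1; omega
  · intro E i hi
    have hex : ∃ τ, E.active i τ = true := ⟨E.gst, E.active_of_gst_le i hi _ le_rfl⟩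
    classical
    have hzero : ∀ τ ≤ Nat.find hex, E.state i τ = 0 := by
      intro τ
      induction τ with
      | zero =>
        obtain ⟨u, hu⟩ := Option.isSome_iff_exists.1 hi
        exact fun _ => E.state_zero i u hu
      | succ τ ih =>
        intro h
        rw [hsucc E i hi, if_neg (Nat.find_min hex h), ih (by omega)]
    exact ⟨Nat.find hex, v, constantAlgorithm_decidesAt.2
      ⟨Nat.find_spec hex, hzero _ le_rfl, rfl⟩⟩
  · intro E i j τ τ' w w' _ _ h h'
    rw [constantAlgorithm_decidesAt] at h h'
    exact h.2.2.symm.trans h'.2.2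
  · intro E i τ w _ h
    rw [constantAlgorithm_decidesAt] at h
    exact h.2.2 ▸ Set.mem_iInter.1 hv E.input

end Constant

/-! ### Solvability and always admissible values -/

theorem theorem2 {VI VO : Type*} [Primcodable VI] [Primcodable VO] [Nonempty VI]
    (n t δ : ℕ) (ht : 0 < t) (htn : t < n) (hδ : 0 < δ) (hn : n ≤ 3 * t) :
    (∃ alwaysAdmissible : Code × Code → Code, Computable alwaysAdmissible ∧
      ∀ (val : ValidityProperty n t VI VO) (A : Algorithm n VI VO) (p : Code × Code),
        Implements p A → SolvesConsensus δ A val →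
          IsAlwaysAdmissibleProcedure val (alwaysAdmissible p)) ∧
    ∀ val : ValidityProperty n t VI VO,
      Solvable δ val ↔ ∃ q : Code, IsAlwaysAdmissibleProcedure val q := by
  obtain ⟨S, -, hS⟩ := Finset.exists_subset_card_eq
    (show n - t ≤ (Finset.univ : Finset (Fin n)).card by simp)
  obtain ⟨i, hi⟩ : S.Nonempty := by rw [← Finset.card_pos]; omega
  let f : Fin n → VI := fun _ => Classical.arbitrary VI
  obtain ⟨q, hq, hqeval⟩ := Partrec.exists_computable_code
    (partrec_simulatedDecision (S := S) (f := f) (VO := VO) i)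
  have hproc : ∀ (val : ValidityProperty n t VI VO) (A : Algorithm n VI VO) (p : Code × Code),
      Implements p A → SolvesConsensus δ A val → IsAlwaysAdmissibleProcedure val (q p) := by
    intro val A p hp hA
    obtain ⟨v, hv, hdec⟩ := simulatedDecision_eq hS.ge hp hi
      (hA.exists_silent_decision hδ (InputConfig.ofFinset S hS.ge f)
        (InputConfig.ofFinset_isSome.2 hi))
    exact ⟨v, by rw [hqeval, hv, Part.map_some], hdec.mem_iInter_adm hA ht htn hδ hn hS⟩
  refine ⟨⟨q, hq, hproc⟩, fun val => ⟨?_, ?_⟩⟩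
  · rintro ⟨A, p, hp, hA⟩
    exact ⟨q p, hproc val A p hp hA⟩
  · rintro ⟨_, v, -, hv⟩
    obtain ⟨p, hp⟩ := constantAlgorithm_implements (n := n) (VI := VI) v
    exact ⟨constantAlgorithm n VI v, p, hp, constantAlgorithm_solves hv⟩
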